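/- Let $k\ge 2$ and $t_L,t_R\ge 0$ be integers, and let $L$ and $R$ be disjoint sets of $k$ parties each. The parties run a deterministic protocol in synchronous rounds over the bipartite network, in which two parties share a bidirectional channel exactly if one is in $L$ and the other in $R$; the receiver of a message knows its sender, and no signatures or other cryptographic setup are available (unauthenticated setting). Each party holds as input a preference list, i.e. a permutation of the parties on the other side. An adversary corrupts at most $t_L$ parties of $L$ and at most $t_R$ parties of $R$; from its corruption on, a party is byzantine and may send arbitrary messages over its channels. Parties that are never corrupted are honest. A protocol achieves byzantine stable matching ($\mathsf{bSM}$) with respect to $t_L,t_R$ if in every such execution the following hold. - Termination: every honest party outputs either a party on the opposite side or nobody. - Symmetry: for honest $u,v$, if $u$ outputs $v$, then $v$ outputs $u$. - Stability: there are no honest $u\in L$, $v\in R$ who both strictly prefer each other to their own outputs, where every party on the opposite side is preferred to nobody. - Non-competition: two different honest parties never output the same party. We say that $\mathsf{bSM}$ is solvable if some protocol achieves it. **Theorem.** $\mathsf{bSM}$ is solvable in the bipartite unauthenticated network if and only if both of the following hold: (i) $t_L<k/2$ and $t_R<k/2$; (ii) $t_L<k/3$ or $t_R<k/3$. This equivalence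 holds both for static adversaries, which choose the corrupted parties at the beginning of the execution, and for adaptive adversaries, which may corrupt parties at any point of the execution. -/

import Mathlib

namespace ByzantineMatching

/-- The `2 * k` parties: `Sum.inl i` is the `i`-th party of `L`, `Sum.inr j` the `j`-th of `R`. -/
abbrev Party (k : ℕ) : Type := Fin k ⊕ Fin k

/-- A preference list over the `k` parties of the opposite side, which are named by their index
there: `pref n` is the party at position `n` of the list. -/
abbrev PrefList (k : ℕ) : Type := Equiv.Perm (Fin k)

/-- `pref.Prefers v m`: the holder of the list `pref` strictly prefers the opposite party `v` to its
current situation `m`, which is either `some w` (matched with `w`) or `none` (alone). Every party is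
preferred to being alone. -/
def PrefList.Prefers {k : ℕ} (pref : PrefList k) (v : Fin k) : Option (Fin k) → Prop
  | none => True
  | some w => pref.symm v < pref.symm w

/-- The bipartite network: two parties share a channel exactly if they are on opposite sides. -/
abbrev bipartiteNetwork (k : ℕ) : SimpleGraph (Party k) := completeBipartiteGraph (Fin k) (Fin k)

/-- A deterministic protocol in the synchronous round model without cryptographic setup. In each
round a party sends to every party at most one message (`none` is silence), computed from its local
state, and then updates its state from the messages received in that round; the receiver knows the
sender of each message. The code of a party may depend on its identity. `output p s = some m` means
that party `p`, in the local state `s`, outputs the match `m`, which is a party of the opposite side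
or nobody (`none`); `output p s = none` means that it outputs nothing in that state. -/
structure Protocol (k : ℕ) where
  Msg : Type
  State : Type
  init : Party k → PrefList k → State
  send : Party k → State → Party k → Option Msg
  step : Party k → State → (Party k → Option Msg) → State
  output : Party k → State → Option (Option (Fin k))

namespace Protocol

variable {k : ℕ}

open Classical in
/-- The local state of each party at the beginning of round `r` if the inputs are `input` and
`sent r p q` is the message that `p` addresses to `q` in round `r`. Messages are delivered, in the
round in which they are sent, along the channels of the network `G` only. -/
noncomputable def state (P : Protocol k) (G : SimpleGraph (Party k)) (input : Party k → PrefList k)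
    (sent : ℕ → Party k → Party k → Option P.Msg) : ℕ → Party k → P.State
  | 0, p => P.init p (input p)
  | r + 1, p => P.step p (P.state G input sent r p)
      (fun q => if G.Adj q p then sent r q p else none)

end Protocol

/-- A static adversary chooses the parties to corrupt at the beginning of the execution, an adaptive
one at any point of it. -/
inductive AdversaryKind
  | static
  | adaptive

/-- An execution of the protocol `P` in the network `G`. The party `p` becomes byzantine in round
`corruptedAt p` (and stays so); it is honest if `corruptedAt p = ⊤`, i.e. it is never corrupted. Up
to its corruption a party follows the protocol; from that round on its messages are arbitrary (they
may depend in any way on all that happens in the execution). -/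
structure Execution {k : ℕ} (P : Protocol k) (G : SimpleGraph (Party k)) where
  input : Party k → PrefList k
  corruptedAt : Party k → ℕ∞
  sent : ℕ → Party k → Party k → Option P.Msg
  follows : ∀ (r : ℕ) (p : Party k), (r : ℕ∞) < corruptedAt p →
    ∀ q, sent r p q = P.send p (P.state G input sent r p) q

namespace Execution

variable {k : ℕ} {P : Protocol k} {G : SimpleGraph (Party k)}

def Honest (E : Execution P G) (p : Party k) : Prop := E.corruptedAt p = ⊤

/-- At most `tL` parties of `L` and at most `tR` parties of `R` are ever corrupted, at a time that
is allowed to the given kind of adversary. -/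
def Admissible (E : Execution P G) (kind : AdversaryKind) (tL tR : ℕ) : Prop :=
  (Finset.univ.filter fun i : Fin k => E.corruptedAt (Sum.inl i) ≠ ⊤).card ≤ tL ∧
  (Finset.univ.filter fun j : Fin k => E.corruptedAt (Sum.inr j) ≠ ⊤).card ≤ tR ∧
  match kind with
  | .static => ∀ p, E.corruptedAt p = 0 ∨ E.corruptedAt p = ⊤
  | .adaptive => True

/-- `p` outputs `m`: the first value that `p` ever outputs is `m`. In particular an output is final
and a party has at most one. -/
def Outputs (E : Execution P G) (p : Party k) (m : Option (Fin k)) : Prop :=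
  ∃ r : ℕ, P.output p (P.state G E.input E.sent r p) = some m ∧
    ∀ r' < r, P.output p (P.state G E.input E.sent r' p) = none

/-- Every honest party outputs a party on the opposite side or nobody. -/
def Termination (E : Execution P G) : Prop :=
  ∀ p, E.Honest p → ∃ m, E.Outputs p m

/-- For two honest parties `u`, `v`: if one decides to match the other, then also conversely. -/
def Symmetry (E : Execution P G) : Prop :=
  ∀ u v : Fin k, E.Honest (Sum.inl u) → E.Honest (Sum.inr v) →
    (E.Outputs (Sum.inl u) (some v) ↔ E.Outputs (Sum.inr v) (some u))

/-- The honest parties `u` in `L` and `v` in `R` prefer each other to their current matches. (As the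
preference is strict, this cannot hold if they are matched to each other.) -/
def Blocking (E : Execution P G) (u v : Fin k) : Prop :=
  E.Honest (Sum.inl u) ∧ E.Honest (Sum.inr v) ∧
  ∃ m m' : Option (Fin k), E.Outputs (Sum.inl u) m ∧ E.Outputs (Sum.inr v) m' ∧
    (E.input (Sum.inl u)).Prefers v m ∧ (E.input (Sum.inr v)).Prefers u m'

/-- There is no blocking pair of honest parties. -/
def Stability (E : Execution P G) : Prop := ∀ u v : Fin k, ¬ E.Blocking u v

/-- Two different honest parties never output the same party. (Outputs of parties on different sides
are on different sides, so this concerns two parties of one side.) -/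
def NonCompetition (E : Execution P G) : Prop :=
  (∀ u u' v : Fin k, u ≠ u' → E.Honest (Sum.inl u) → E.Honest (Sum.inl u') →
    ¬ (E.Outputs (Sum.inl u) (some v) ∧ E.Outputs (Sum.inl u') (some v))) ∧
  (∀ v v' u : Fin k, v ≠ v' → E.Honest (Sum.inr v) → E.Honest (Sum.inr v') →
    ¬ (E.Outputs (Sum.inr v) (some u) ∧ E.Outputs (Sum.inr v') (some u)))

end Execution

/-- `P` achieves byzantine stable matching in the network `G` with respect to `tL` and `tR`. -/
def AchievesBSM {k : ℕ} (P : Protocol k) (G : SimpleGraph (Party k)) (kind : AdversaryKind)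
    (tL tR : ℕ) : Prop :=
  ∀ E : Execution P G, E.Admissible kind tL tR →
    E.Termination ∧ E.Symmetry ∧ E.Stability ∧ E.NonCompetition

/-- Byzantine stable matching is solvable in the (unauthenticated) network `G`. -/
def BSMSolvable {k : ℕ} (G : SimpleGraph (Party k)) (kind : AdversaryKind) (tL tR : ℕ) : Prop :=
  ∃ P : Protocol k, AchievesBSM P G kind tL tR

end ByzantineMatching

/-! Impossibility is a covering argument. A hypothetical protocol is run on a double cover of the
network. Wherever the honest parties lift consistently to copies, their views in the cover are those
of a genuine execution, because each byzantine party can imitate towards every neighbour the copy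
which that neighbour sees (`Protocol.state_coverSent`). In `not_solvable_of_sections` one such
execution forces `c` to output `a`, another forces `d` to output `a` (it contains the other copy of
`a`), and a third contains both copies `c` and `d` as honest parties, against non-competition. Two
covers realise this, for `k ≤ 2 * tL` and for thirds on both sides. The executions are static, hence
admissible for both kinds of adversary.

For solvability let `3 * tL < k` and `2 * tR < k`. The honest majority of `R` relays messages
faithfully, so `L` behaves like a complete network with fewer than a third of its parties corrupted.
There the phase king algorithm gives agreement on all `2 * k` inputs, with the true value for honest
parties (`Execution.coreAt_final`). Everyone then computes the same perfect stable matching.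
Treating every party that is ever corrupted as arbitrary from the start covers adaptive adversaries.
Exchanging the sides gives the remaining cases. -/

namespace ByzantineMatching

variable {k : ℕ}

/-! ### Swapping the two sides -/

/-- The protocol in which every party plays the role of its counterpart on the other side. -/
def Protocol.swap (P : Protocol k) : Protocol k where
  Msg := P.Msg
  State := P.State
  init p := P.init p.swap
  send p s q := P.send p.swap s q.swap
  step p s rcv := P.step p.swap s (fun q => rcv q.swap)
  output p := P.output p.swap

lemma bipartiteNetwork_adj_swap (p q : Party k) :
    (bipartiteNetwork k).Adj p.swap q.swap ↔ (bipartiteNetwork k).Adj p q := by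
  rcases p with p | p <;> rcases q with q | q <;> simp [completeBipartiteGraph]

lemma Protocol.state_swap (P : Protocol k) (input : Party k → PrefList k)
    (sent : ℕ → Party k → Party k → Option P.Msg) (r : ℕ) (p : Party k) :
    P.swap.state (bipartiteNetwork k) input sent r p =
      P.state (bipartiteNetwork k) (fun p => input p.swap)
        (fun r p q => sent r p.swap q.swap) r p.swap := by
  induction r generalizing p with
  | zero => simp [Protocol.state, Protocol.swap]
  | succ r ih =>
    simp only [Protocol.state, ih]
    simp only [Protocol.swap, Sum.swap_swap]
    congr 1
    funext q
    have := bipartiteNetwork_adj_swap q p.swap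
    simp only [Sum.swap_swap] at this
    by_cases h : (bipartiteNetwork k).Adj q p.swap
    · rw [if_pos h, if_pos (this.2 h)]
    · rw [if_neg h, if_neg (fun h' => h (this.1 h'))]

/-- An execution of the swapped protocol, seen as an execution of the protocol. -/
def Execution.swap {P : Protocol k} (E : Execution P.swap (bipartiteNetwork k)) :
    Execution P (bipartiteNetwork k) where
  input p := E.input p.swap
  corruptedAt p := E.corruptedAt p.swap
  sent r p q := E.sent r p.swap q.swap
  follows r p hp q := by
    have h := P.state_swap E.input E.sent r p.swap
    rw [Sum.swap_swap] at h
    refine (E.follows r p.swap hp q.swap).trans ?_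
    rw [← h]
    simp [Protocol.swap]

lemma Execution.outputs_swap {P : Protocol k} (E : Execution P.swap (bipartiteNetwork k))
    (p : Party k) (m : Option (Fin k)) : E.swap.Outputs p.swap m ↔ E.Outputs p m := by
  have h := fun r => (P.state_swap E.input E.sent r p).symm
  exact exists_congr fun r => and_congr
    (iff_of_eq (congrArg (fun s => P.output p.swap s = some m) (h r)))
    (forall₂_congr fun r' _ => iff_of_eq (congrArg (fun s => P.output p.swap s = none) (h r')))

lemma Execution.honest_swap {P : Protocol k} (E : Execution P.swap (bipartiteNetwork k))
    (p : Party k) : E.swap.Honest p.swap ↔ E.Honest p := by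
  simp [Execution.Honest, Execution.swap]

lemma BSMSolvable.swap {kind : AdversaryKind} {tL tR : ℕ}
    (h : BSMSolvable (bipartiteNetwork k) kind tL tR) :
    BSMSolvable (bipartiteNetwork k) kind tR tL := by
  obtain ⟨P, hP⟩ := h
  refine ⟨P.swap, fun E hE => ?_⟩
  have hE' : E.swap.Admissible kind tL tR := by
    refine ⟨hE.2.1, hE.1, ?_⟩
    cases kind
    · exact fun p => hE.2.2 p.swap
    · trivial
  obtain ⟨ht, hs, hst, hn⟩ := hP E.swap hE'
  have oL := fun (u : Fin k) m => E.outputs_swap (Sum.inl u) m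
  have oR := fun (u : Fin k) m => E.outputs_swap (Sum.inr u) m
  have hL := fun (u : Fin k) => E.honest_swap (Sum.inl u)
  have hR := fun (u : Fin k) => E.honest_swap (Sum.inr u)
  simp only [Sum.swap_inl, Sum.swap_inr] at oL oR hL hR
  refine ⟨fun p hp => ?_, fun u v hu hv => ?_, fun u v hb => ?_, ?_, ?_⟩
  · obtain ⟨m, hm⟩ := ht p.swap ((E.honest_swap p).2 hp)
    exact ⟨m, (E.outputs_swap p m).1 hm⟩
  · rw [← oL, ← oR]
    exact (hs v u ((hR v).2 hv) ((hL u).2 hu)).symm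
  · obtain ⟨hu, hv, m, m', hm, hm', hp, hp'⟩ := hb
    exact hst v u ⟨(hR v).2 hv, (hL u).2 hu, m', m, (oR _ _).2 hm', (oL _ _).2 hm, hp', hp⟩
  · intro u u' v huu hu hu' ho
    exact hn.2 u u' v huu ((hL u).2 hu) ((hL u').2 hu') ⟨(oL _ _).2 ho.1, (oL _ _).2 ho.2⟩
  · intro u u' v huu hu hu' ho
    exact hn.1 u u' v huu ((hR u).2 hu) ((hR u').2 hu') ⟨(oR _ _).2 ho.1, (oR _ _).2 ho.2⟩

/-! ### Impossibility: double covers of the network -/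

/-- Honest parties that are at the top of each other's lists are matched. -/
lemma Execution.outputs_of_mutual_top {P : Protocol k} {G : SimpleGraph (Party k)}
    {E : Execution P G} (ht : E.Termination) (hs : E.Symmetry) (hst : E.Stability) {u v : Fin k}
    (hu : E.Honest (Sum.inl u)) (hv : E.Honest (Sum.inr v))
    (huv : ∀ w, w ≠ v → (E.input (Sum.inl u)).symm v < (E.input (Sum.inl u)).symm w)
    (hvu : ∀ w, w ≠ u → (E.input (Sum.inr v)).symm u < (E.input (Sum.inr v)).symm w) :
    E.Outputs (Sum.inr v) (some u) := by
  obtain ⟨m, hm⟩ := ht _ hu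
  obtain ⟨m', hm'⟩ := ht _ hv
  by_contra hcon
  have h1 : m ≠ some v := fun h => hcon ((hs u v hu hv).1 (h ▸ hm))
  have h2 : m' ≠ some u := fun h => hcon (h ▸ hm')
  refine hst u v ⟨hu, hv, m, m', hm, hm', ?_, ?_⟩
  · cases m with
    | none => trivial
    | some w => exact huv w (fun h => h1 (h ▸ rfl))
  · cases m' with
    | none => trivial
    | some w => exact hvu w (fun h => h2 (h ▸ rfl))

open Classical in
/-- The local states when `P` is run on the double cover of the network `G` with voltages `w`:
the copy `b` of `p` is linked to the copy `b ^^ w p q` of `q`. -/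
noncomputable def Protocol.coverState (P : Protocol k) (G : SimpleGraph (Party k))
    (w : Party k → Party k → Bool) (input : Party k → Bool → PrefList k) :
    ℕ → Party k → Bool → P.State
  | 0, p, b => P.init p (input p b)
  | r + 1, p, b => P.step p (P.coverState G w input r p b)
      (fun q => if G.Adj q p then P.send q (P.coverState G w input r q (b ^^ w p q)) p else none)

open Classical in
/-- The messages in the execution that a section `s` over the set `S` of honest parties induces. -/
noncomputable def Protocol.coverSent (P : Protocol k) (G : SimpleGraph (Party k))
    (w : Party k → Party k → Bool) (input : Party k → Bool → PrefList k)
    (S : Set (Party k)) (s : Party k → Bool) (r : ℕ) (p q : Party k) : Option P.Msg :=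
  if p ∈ S then P.send p (P.coverState G w input r p (s p)) q
  else P.send p (P.coverState G w input r p (s q ^^ w q p)) q

/-- Consistency of the section says that honest neighbours sit on adjacent copies; a party outside
`S` sends to each `q` what the copy adjacent to that of `q` would send. So no party of `S` can tell
the network from the cover. -/
lemma Protocol.state_coverSent (P : Protocol k) (G : SimpleGraph (Party k))
    (w : Party k → Party k → Bool) (input : Party k → Bool → PrefList k)
    (S : Set (Party k)) (s : Party k → Bool)
    (hs : ∀ p ∈ S, ∀ q ∈ S, G.Adj q p → s q = (s p ^^ w p q)) (r : ℕ) (p : Party k) (hp : p ∈ S) :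
    P.state G (fun p => input p (s p)) (P.coverSent G w input S s) r p =
      P.coverState G w input r p (s p) := by
  induction r generalizing p with
  | zero => rfl
  | succ r ih =>
    simp only [Protocol.state, Protocol.coverState, ih p hp]
    congr 1
    funext q
    by_cases h : G.Adj q p
    · rw [if_pos h, if_pos h]
      by_cases hq : q ∈ S
      · rw [Protocol.coverSent, if_pos hq, hs p hp q hq h]
      · rw [Protocol.coverSent, if_neg hq]
    · rw [if_neg h, if_neg h]

open Classical in
/-- The execution with the honest parties `S` that a section over `S` induces. -/
noncomputable def Protocol.coverExecution (P : Protocol k) (G : SimpleGraph (Party k))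
    (w : Party k → Party k → Bool) (input : Party k → Bool → PrefList k)
    (S : Set (Party k)) (s : Party k → Bool)
    (hs : ∀ p ∈ S, ∀ q ∈ S, G.Adj q p → s q = (s p ^^ w p q)) : Execution P G where
  input p := input p (s p)
  corruptedAt p := if p ∈ S then ⊤ else 0
  sent := P.coverSent G w input S s
  follows r p hp q := by
    have hpS : p ∈ S := by
      by_contra h
      simp [h] at hp
    rw [P.state_coverSent G w input S s hs r p hpS, Protocol.coverSent, if_pos hpS]

section Cover

variable (P : Protocol k) (G : SimpleGraph (Party k)) (w : Party k → Party k → Bool)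
  (input : Party k → Bool → PrefList k) (S : Set (Party k)) (s : Party k → Bool)
  (hs : ∀ p ∈ S, ∀ q ∈ S, G.Adj q p → s q = (s p ^^ w p q))

lemma Protocol.coverExecution_honest (p : Party k) :
    (P.coverExecution G w input S s hs).Honest p ↔ p ∈ S := by
  simp only [Execution.Honest, Protocol.coverExecution]
  split_ifs with h <;> simp [h]

lemma Protocol.coverExecution_outputs (p : Party k) (hp : p ∈ S) (m : Option (Fin k)) :
    (P.coverExecution G w input S s hs).Outputs p m ↔
      ∃ r : ℕ, P.output p (P.coverState G w input r p (s p)) = some m ∧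
        ∀ r' < r, P.output p (P.coverState G w input r' p (s p)) = none := by
  simp only [Execution.Outputs]
  have := fun r => P.state_coverSent G w input S s hs r p hp
  simp only [Protocol.coverExecution, this]

open Classical in
lemma Protocol.coverExecution_admissible (kind : AdversaryKind) (tL tR : ℕ)
    (hL : (Finset.univ.filter fun i : Fin k => Sum.inl i ∉ S).card ≤ tL)
    (hR : (Finset.univ.filter fun i : Fin k => Sum.inr i ∉ S).card ≤ tR) :
    (P.coverExecution G w input S s hs).Admissible kind tL tR := by
  have key : ∀ p, (P.coverExecution G w input S s hs).corruptedAt p ≠ ⊤ ↔ p ∉ S := fun p =>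
    not_congr (P.coverExecution_honest G w input S s hs p)
  refine ⟨?_, ?_, ?_⟩
  · refine le_trans (le_of_eq ?_) hL
    congr 1
    ext i
    simp [key]
  · refine le_trans (le_of_eq ?_) hR
    congr 1
    ext i
    simp [key]
  · cases kind
    · intro p
      by_cases h : p ∈ S <;> simp [Protocol.coverExecution, h]
    · trivial

end Cover

/-- A preference list with `v` at the top. -/
lemma PrefList.exists_top (v : Fin k) :
    ∃ l : PrefList k, ∀ w, w ≠ v → l.symm v < l.symm w := by
  have : NeZero k := ⟨by rintro rfl; exact v.elim0⟩
  refine ⟨Equiv.swap 0 v, fun w hw => ?_⟩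
  rw [Equiv.symm_swap, Equiv.swap_apply_right]
  refine Fin.pos_iff_ne_zero.2 fun h => hw ?_
  have := congrArg (Equiv.swap 0 v) h
  simpa using this

open Classical in
/-- If `a` and `c` are honest in one section, another copy of `a` and `d` in a second one, and the
same copies of `c` and `d` in a third one, then byzantine stable matching is not solvable. -/
theorem not_solvable_of_sections (kind : AdversaryKind) (tL tR : ℕ)
    (w : Party k → Party k → Bool) (S : Fin 3 → Set (Party k)) (s : Fin 3 → Party k → Bool)
    (hs : ∀ i, ∀ p ∈ S i, ∀ q ∈ S i, (bipartiteNetwork k).Adj q p → s i q = (s i p ^^ w p q))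
    (hL : ∀ i, (Finset.univ.filter fun j : Fin k => Sum.inl j ∉ S i).card ≤ tL)
    (hR : ∀ i, (Finset.univ.filter fun j : Fin k => Sum.inr j ∉ S i).card ≤ tR)
    (a c d : Fin k) (hcd : c ≠ d)
    (ha0 : Sum.inl a ∈ S 0) (hc0 : Sum.inr c ∈ S 0) (ha1 : Sum.inl a ∈ S 1)
    (hd1 : Sum.inr d ∈ S 1) (hc2 : Sum.inr c ∈ S 2) (hd2 : Sum.inr d ∈ S 2)
    (hc : s 0 (Sum.inr c) = s 2 (Sum.inr c)) (hd : s 1 (Sum.inr d) = s 2 (Sum.inr d))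
    (ha : s 0 (Sum.inl a) ≠ s 1 (Sum.inl a)) :
    ¬ BSMSolvable (bipartiteNetwork k) kind tL tR := by
  rintro ⟨P, hP⟩
  choose top htop using PrefList.exists_top (k := k)
  -- The two copies of `a` want `c` and `d` respectively, while all of `R` wants `a`: this creates a
  -- mutual top pair in each of the first two executions.
  let input : Party k → Bool → PrefList k := fun p b => match p with
    | Sum.inl _ => if b = s 0 (Sum.inl a) then top c else top d
    | Sum.inr _ => top a
  let E : Fin 3 → Execution P (bipartiteNetwork k) := fun i =>
    P.coverExecution _ w input (S i) (s i) (hs i)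
  have hE := fun i => hP (E i)
    (P.coverExecution_admissible _ w input (S i) (s i) (hs i) kind tL tR (hL i) (hR i))
  have hon : ∀ i p, p ∈ S i → (E i).Honest p := fun i p hp =>
    (P.coverExecution_honest _ w input (S i) (s i) (hs i) p).2 hp
  have out := fun i p hp m => P.coverExecution_outputs _ w input (S i) (s i) (hs i) p hp m
  have h0 : (E 0).Outputs (Sum.inr c) (some a) := by
    refine Execution.outputs_of_mutual_top (hE 0).1 (hE 0).2.1 (hE 0).2.2.1 (hon 0 _ ha0)
      (hon 0 _ hc0) ?_ (htop a)
    simpa [E, Protocol.coverExecution, input] using htop c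
  have h1 : (E 1).Outputs (Sum.inr d) (some a) := by
    refine Execution.outputs_of_mutual_top (hE 1).1 (hE 1).2.1 (hE 1).2.2.1 (hon 1 _ ha1)
      (hon 1 _ hd1) ?_ (htop a)
    simpa [E, Protocol.coverExecution, input, ha.symm] using htop d
  have h0' : (E 2).Outputs (Sum.inr c) (some a) := by
    rw [out 2 _ hc2, ← hc, ← out 0 _ hc0]
    exact h0
  have h1' : (E 2).Outputs (Sum.inr d) (some a) := by
    rw [out 2 _ hd2, ← hd, ← out 1 _ hd1]
    exact h1
  exact (hE 2).2.2.2.2 c d a hcd (hon 2 _ hc2) (hon 2 _ hd2) ⟨h0', h1'⟩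

/-- Split `L` into halves `A` and `B`, let `D` be `R` without its party `0`, and twist exactly the
`A`–`D` edges. With `B` corrupted the twist is the coboundary of `D`, so `A ∪ R` has two
complementary sections; with `A` corrupted nothing is twisted and the zero section works. No party
of `R` is corrupted. -/
theorem not_solvable_of_half (hk : 2 ≤ k) (kind : AdversaryKind) (tL tR : ℕ) (h : k ≤ 2 * tL) :
    ¬ BSMSolvable (bipartiteNetwork k) kind tL tR := by
  classical
  let A : Party k → Bool := Sum.elim (fun i => decide (2 * i.val < k)) (fun _ => false)
  let D : Party k → Bool := Sum.elim (fun _ => false) (fun j => decide (j.val ≠ 0))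
  let B : Party k → Bool := Sum.elim (fun i => decide (k ≤ 2 * i.val)) (fun _ => false)
  have hcard : ∀ i : Fin 3, (Finset.univ.filter fun j : Fin k =>
      Sum.inl j ∉ (![{p | B p = false}, {p | B p = false}, {p | A p = false}] :
        Fin 3 → Set (Party k)) i).card ≤ tL := by
    intro i
    have h1 : (Finset.univ.filter fun j : Fin k => k ≤ 2 * j.val).card ≤ tL := by
      calc _ = ((Finset.univ.filter fun j : Fin k => k ≤ 2 * j.val).map Fin.valEmbedding).card :=
            (Finset.card_map _).symm
        _ ≤ (Finset.Ico (k - tL) k).card := Finset.card_le_card (by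
            intro x hx
            simp only [Finset.mem_map, Finset.mem_filter, Finset.mem_univ, true_and,
              Fin.valEmbedding_apply] at hx
            obtain ⟨j, hj, rfl⟩ := hx
            have := j.isLt
            simp only [Finset.mem_Ico]
            omega)
        _ ≤ tL := by simp; omega
    have h2 : (Finset.univ.filter fun j : Fin k => 2 * j.val < k).card ≤ tL := by
      calc _ = ((Finset.univ.filter fun j : Fin k => 2 * j.val < k).map Fin.valEmbedding).card :=
            (Finset.card_map _).symm
        _ ≤ (Finset.range tL).card := Finset.card_le_card (by
            intro x hx
            simp only [Finset.mem_map, Finset.mem_filter, Finset.mem_univ, true_and,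
              Fin.valEmbedding_apply] at hx
            obtain ⟨j, hj, rfl⟩ := hx
            simp only [Finset.mem_range]
            omega)
        _ ≤ tL := by simp
    fin_cases i
    · simpa [B] using h1
    · simpa [B] using h1
    · simpa [A] using h2
  refine not_solvable_of_sections kind tL tR
    (fun p q => (A p && D q) || (A q && D p))
    ![{p | B p = false}, {p | B p = false}, {p | A p = false}]
    ![fun p => D p, fun p => ! D p, fun _ => false] ?_ hcard ?_
    ⟨0, by omega⟩ ⟨0, by omega⟩ ⟨1, by omega⟩ (by simp) ?_ ?_ ?_ ?_ ?_ ?_ ?_ ?_ ?_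
  · intro i p hp q hq hpq
    fin_cases i <;> rcases p with p | p <;> rcases q with q | q <;>
      simp_all [A, B, D]
  · intro i
    fin_cases i <;> simp [A, B]
  all_goals simp [A, B, D]
  all_goals omega

/-- Within one residue class, `j ↦ j / 3` is injective. -/
lemma card_filter_add_mod_three_le (c t i : ℕ) (h : k ≤ 3 * t) :
    (Finset.univ.filter fun j : Fin k => (j.val + c) % 3 = i).card ≤ t := by
  calc _ ≤ (Finset.range t).card := by
        refine Finset.card_le_card_of_injOn (fun j => j.val / 3) ?_ ?_
        · intro j _
          have := j.isLt
          simp only [Finset.coe_range, Set.mem_Iio]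
          omega
        · intro j hj j' hj' hjj
          simp only [Finset.coe_filter, Finset.mem_univ, true_and, Set.mem_ofPred_eq] at hj hj' hjj
          ext
          omega
    _ = t := Finset.card_range t

/-- The classical hexagon: three classes, each containing about a third of both sides, with the
edges between classes `0` and `2` twisted. Each execution corrupts one class. -/
theorem not_solvable_of_third (hk : 2 ≤ k) (kind : AdversaryKind) (tL tR : ℕ) (hL : k ≤ 3 * tL)
    (hR : k ≤ 3 * tR) : ¬ BSMSolvable (bipartiteNetwork k) kind tL tR := by
  classical
  -- The shift by one on `R` puts `a`, `c`, `d` (indices `0`, `0`, `1`) into the classes `0`, `1`,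
  -- `2`.
  let g : Party k → ℕ := Sum.elim (fun i => i.val % 3) (fun j => (j.val + 1) % 3)
  have hg : ∀ p, g p = 0 ∨ g p = 1 ∨ g p = 2 := by
    rintro (p | p) <;> simp only [g, Sum.elim_inl, Sum.elim_inr] <;> omega
  refine not_solvable_of_sections kind tL tR
    (fun p q => (decide (g p = 0) && decide (g q = 2)) || (decide (g q = 0) && decide (g p = 2)))
    ![{p | g p ≠ 2}, {p | g p ≠ 1}, {p | g p ≠ 0}]
    ![fun _ => false, fun p => decide (g p = 0), fun _ => false] ?_ ?_ ?_
    ⟨0, by omega⟩ ⟨0, by omega⟩ ⟨1, by omega⟩ (by simp) ?_ ?_ ?_ ?_ ?_ ?_ ?_ ?_ ?_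
  · intro i p hp q hq _
    rcases hg p with h | h | h <;> rcases hg q with h' | h' | h' <;>
      fin_cases i <;> simp_all
  · intro i
    fin_cases i
    · simpa [g] using card_filter_add_mod_three_le 0 tL 2 hL
    · simpa [g] using card_filter_add_mod_three_le 0 tL 1 hL
    · simpa [g] using card_filter_add_mod_three_le 0 tL 0 hL
  · intro i
    fin_cases i
    · simpa [g] using card_filter_add_mod_three_le 1 tR 2 hR
    · simpa [g] using card_filter_add_mod_three_le 1 tR 1 hR
    · simpa [g] using card_filter_add_mod_three_le 1 tR 0 hR
  all_goals simp [g]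

/-! ### Existence of stable matchings -/

/-- Gale and Shapley: there is a perfect matching without blocking pairs. -/
theorem exists_stable_matching (prefL prefR : Fin k → PrefList k) :
    ∃ f : Equiv.Perm (Fin k), ∀ u v : Fin k,
      ¬ ((prefL u).symm v < (prefL u).symm (f u) ∧
        (prefR v).symm u < (prefR v).symm (f.symm v)) := by
  classical
  -- `c u` is the position, in the list of `u`, of the party to which `u` currently proposes
  let good : Finset (Fin k → Fin k) := Finset.univ.filter fun c =>
    ∀ u v, (prefL u).symm v < c u →
      ∃ u', prefL u' (c u') = v ∧ (prefR v).symm u' < (prefR v).symm u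
  have hne : good.Nonempty := by
    rcases Nat.eq_zero_or_pos k with rfl | hk
    · exact ⟨fun u => u.elim0, Finset.mem_filter.2 ⟨Finset.mem_univ _, fun u => u.elim0⟩⟩
    · have : NeZero k := ⟨hk.ne'⟩
      exact ⟨fun _ => 0, by simp [good]⟩
  obtain ⟨c, hc, hmax⟩ := good.exists_max_image (fun c => ∑ u, (c u).val) hne
  simp only [good, Finset.mem_filter, Finset.mem_univ, true_and] at hc hmax
  -- `good` is the invariant of deferred acceptance: whoever has rejected `u` currently holds a
  -- better proposal. In a good state with maximal total progress no two proposals collide, since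
  -- otherwise the rejected proposer could advance.
  have hinj : Function.Injective fun u => prefL u (c u) := by
    by_contra hni
    have key : ∀ u₁ u₂, u₁ ≠ u₂ → prefL u₁ (c u₁) = prefL u₂ (c u₂) →
        (prefR (prefL u₂ (c u₂))).symm u₁ < (prefR (prefL u₂ (c u₂))).symm u₂ → False := by
      intro u₁ u₂ h12 hw hlt
      -- If `u₂` were at the end of its list, everyone would hold a proposal, so the proposals would
      -- be surjective and hence injective.
      have hlast : (c u₂).val + 1 < k := by
        by_contra hcon
        refine hni (Finite.injective_iff_surjective.2 fun v => ?_)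
        by_cases hv : v = prefL u₂ (c u₂)
        · exact ⟨u₂, hv.symm⟩
        · have hne' : (prefL u₂).symm v ≠ c u₂ := fun h => hv (by rw [← h]; simp)
          have : (prefL u₂).symm v < c u₂ := by
            have h1 := ((prefL u₂).symm v).isLt
            have h2 : ((prefL u₂).symm v).val ≠ (c u₂).val := fun h => hne' (Fin.ext h)
            rw [Fin.lt_def]
            omega
          obtain ⟨u', hu', -⟩ := hc u₂ v this
          exact ⟨u', hu'⟩
      let c' := Function.update c u₂ ⟨(c u₂).val + 1, hlast⟩
      have hc1 : ∀ u, u ≠ u₂ → c' u = c u := fun u hu => Function.update_of_ne hu _ _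
      have hc2 : (c' u₂).val = (c u₂).val + 1 := by simp [c']
      have hgood : ∀ u v, (prefL u).symm v < c' u →
          ∃ u', prefL u' (c' u') = v ∧ (prefR v).symm u' < (prefR v).symm u := by
        intro u v huv
        have hcases : (prefL u).symm v < c u ∨ u = u₂ ∧ v = prefL u₂ (c u₂) := by
          by_cases hu : u = u₂
          · subst hu
            rw [Fin.lt_def, hc2, Nat.lt_succ_iff_lt_or_eq] at huv
            rcases huv with h | h
            · exact Or.inl h
            · exact Or.inr ⟨rfl, by rw [← Fin.ext h]; simp⟩
          · rw [hc1 u hu] at huv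
            exact Or.inl huv
        rcases hcases with h | ⟨rfl, rfl⟩
        · obtain ⟨u', hu', hlt'⟩ := hc u v h
          by_cases hu2 : u' = u₂
          · subst hu2
            subst hu'
            exact ⟨u₁, by rw [hc1 u₁ h12, hw], hlt.trans hlt'⟩
          · exact ⟨u', by rw [hc1 u' hu2, hu'], hlt'⟩
        · exact ⟨u₁, by rw [hc1 u₁ h12, hw], hlt⟩
      have hle := hmax c' hgood
      have hlt' : ∑ u, (c u).val < ∑ u, (c' u).val := by
        refine Finset.sum_lt_sum (fun u _ => ?_) ⟨u₂, Finset.mem_univ _, by omega⟩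
        by_cases hu : u = u₂
        · subst hu
          omega
        · rw [hc1 u hu]
      omega
    simp only [Function.Injective, not_forall] at hni
    obtain ⟨u₁, u₂, hw, h12⟩ := hni
    rcases lt_trichotomy ((prefR (prefL u₂ (c u₂))).symm u₁)
      ((prefR (prefL u₂ (c u₂))).symm u₂) with h | h | h
    · exact key u₁ u₂ h12 hw h
    · exact h12 ((prefR (prefL u₂ (c u₂))).symm.injective h)
    · exact key u₂ u₁ (Ne.symm h12) hw.symm (hw ▸ h)
  let f : Equiv.Perm (Fin k) := Equiv.ofBijective _ (Finite.injective_iff_bijective.1 hinj)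
  refine ⟨f, fun u v ⟨h1, h2⟩ => ?_⟩
  have hfu : ∀ u, f u = prefL u (c u) := fun u => rfl
  rw [hfu, Equiv.symm_apply_apply] at h1
  obtain ⟨u', hu', hlt⟩ := hc u v h1
  rw [← hfu] at hu'
  rw [← hu', Equiv.symm_apply_apply, hu'] at h2
  exact lt_asymm h2 hlt

/-! ### Values reported by many parties -/

open Classical in
/-- Some value that at least `m` entries of `f` report, if there is one. -/
noncomputable def pick {α : Type} (m : ℕ) (f : Fin k → Option α) : Option α :=
  if h : ∃ y, m ≤ (Finset.univ.filter fun q => f q = some y).card then some h.choose else none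

section Pick

open Classical

variable {α : Type} {m t : ℕ} {f : Fin k → Option α} {H : Finset (Fin k)}

lemma pick_spec {y : α} (h : pick m f = some y) :
    m ≤ (Finset.univ.filter fun q => f q = some y).card := by
  unfold pick at h
  split_ifs at h with h'
  rw [← Option.some.inj h]
  exact h'.choose_spec

lemma exists_pick_eq_some {y : α} (h : m ≤ (Finset.univ.filter fun q => f q = some y).card) :
    ∃ z, pick m f = some z := by
  unfold pick
  rw [dif_pos ⟨y, h⟩]
  exact ⟨_, rfl⟩

lemma exists_mem_of_card_compl_lt (hH : Hᶜ.card ≤ t) {s : Finset (Fin k)} (hs : t < s.card) :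
    ∃ q ∈ H, q ∈ s := by
  by_contra! h
  have : s ⊆ Hᶜ := fun q hq => Finset.mem_compl.2 fun hqH => h q hqH hq
  have := Finset.card_le_card this
  omega

lemma exists_mem_of_pick_eq_some (hH : Hᶜ.card ≤ t) (hm : t < m) {y : α}
    (h : pick m f = some y) : ∃ q ∈ H, f q = some y := by
  obtain ⟨q, hq, hq'⟩ := exists_mem_of_card_compl_lt hH (hm.trans_le (pick_spec h))
  exact ⟨q, hq, by simpa using hq'⟩

/-- `t < m` keeps the at most `t` faulty entries from pushing through a value alone; `m + t ≤ k`
lets the honest entries reach the threshold alone. -/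
lemma pick_eq_of_forall_mem (hH : Hᶜ.card ≤ t) (hm : t < m) (hmt : m + t ≤ k) {o : Option α}
    (h : ∀ q ∈ H, f q = o) : pick m f = o := by
  rcases hp : pick m f with _ | y
  · cases o with
    | none => rfl
    | some z =>
      exfalso
      have h1 : H.card + Hᶜ.card = k := by simp
      have h2 : H ⊆ Finset.univ.filter fun q => f q = some z := fun q hq => by simp [h q hq]
      have h3 := Finset.card_le_card h2
      obtain ⟨w, hw⟩ := exists_pick_eq_some (f := f) (m := m) (y := z) (by omega)
      rw [hp] at hw
      cases hw
  · obtain ⟨q, hq, hq'⟩ := exists_mem_of_pick_eq_some hH hm hp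
    rw [← hq', h q hq]

end Pick

/-! ### The phase king algorithm -/

/-- The state of a party in the phase king algorithm for one value. -/
structure PhaseKing (V : Type) where
  val : V
  proposal : Option V
  strong : Prop

namespace PhaseKing

variable {V : Type}

/-- A phase has three rounds: exchange of the values, exchange of the proposals, and the message of
the king. -/
def msg (n : ℕ) (s : PhaseKing V) : Option V := if n % 3 = 1 then s.proposal else some s.val

-- Threshold `k - t` makes honest proposals unique by quorum intersection; threshold `t + 1`
-- guarantees an honest proposer. A strong party ignores the king, and a silent king counts as
-- sending `default`.
open Classical in
noncomputable def next [Inhabited V] (t n : ℕ) (s : PhaseKing V) (rcv : Fin k → Option V) :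
    PhaseKing V :=
  if n % 3 = 0 then { s with proposal := pick (k - t) rcv }
  else if n % 3 = 1 then
    { s with val := (pick (t + 1) rcv).getD s.val, strong := ∃ z, pick (k - t) rcv = some z }
  else if h : n / 3 < k then
    { s with val := if s.strong then s.val else (rcv ⟨n / 3, h⟩).getD default }
  else s

variable [Inhabited V] {t : ℕ} {H : Finset (Fin k)} {s : ℕ → Fin k → PhaseKing V}
  {rcv : ℕ → Fin k → Fin k → Option V}

/-- Unanimity makes every honest party strong, so even a byzantine king changes nothing. -/
lemma phase_persistent (hH : Hᶜ.card ≤ t) (ht : 3 * t < k)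
    (hrcv : ∀ n, ∀ p ∈ H, ∀ q ∈ H, rcv n p q = (s n q).msg n)
    (hs : ∀ n, ∀ p ∈ H, s (n + 1) p = (s n p).next t n (rcv n p)) (φ : ℕ) (v : V)
    (h : ∀ p ∈ H, (s (3 * φ) p).val = v) : ∀ p ∈ H, (s (3 * (φ + 1)) p).val = v := by
  have e0 : 3 * φ % 3 = 0 := by omega
  have e1 : (3 * φ + 1) % 3 = 1 := by omega
  have e2 : (3 * φ + 2) % 3 = 2 := by omega
  have h1 : ∀ p ∈ H, (s (3 * φ + 1) p).proposal = some v := by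
    intro p hp
    rw [hs _ p hp]
    simp only [next, e0, if_true]
    exact pick_eq_of_forall_mem hH (by omega) (by omega) fun q hq => by
      rw [hrcv _ p hp q hq]
      simp [msg, e0, h q hq]
  have h2 : ∀ p ∈ H, (s (3 * φ + 2) p).val = v ∧ (s (3 * φ + 2) p).strong := by
    intro p hp
    rw [hs (3 * φ + 1) p hp]
    simp only [next, e1, if_true, if_neg one_ne_zero]
    have hq : ∀ q ∈ H, rcv (3 * φ + 1) p q = some v := fun q hq => by
      rw [hrcv _ p hp q hq]
      simp [msg, e1, h1 q hq]
    rw [pick_eq_of_forall_mem hH (by omega) (by omega) hq,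
      pick_eq_of_forall_mem hH (by omega) (by omega) hq]
    simp
  intro p hp
  rw [show 3 * (φ + 1) = 3 * φ + 2 + 1 by ring, hs (3 * φ + 2) p hp]
  simp only [next, e2]
  by_cases hφ : (3 * φ + 2) / 3 < k <;> simp [hφ, h2 p hp]

lemma phase_agreement (hH : Hᶜ.card ≤ t) (ht : 3 * t < k)
    (hrcv : ∀ n, ∀ p ∈ H, ∀ q ∈ H, rcv n p q = (s n q).msg n)
    (hs : ∀ n, ∀ p ∈ H, s (n + 1) p = (s n p).next t n (rcv n p)) (φ : ℕ) (hφ : φ < k)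
    (hking : ⟨φ, hφ⟩ ∈ H) : ∃ v, ∀ p ∈ H, (s (3 * (φ + 1)) p).val = v := by
  classical
  have e0 : 3 * φ % 3 = 0 := by omega
  have e1 : (3 * φ + 1) % 3 = 1 := by omega
  have e2 : (3 * φ + 2) % 3 = 2 := by omega
  have e3 : (3 * φ + 2) / 3 = φ := by omega
  have hHc : H.card + Hᶜ.card = k := by simp
  -- Two quorums of size `k - t` share at least `k - 2 * t > t` senders, one of them honest.
  have hprop : ∀ p ∈ H, ∀ p' ∈ H, ∀ y y', (s (3 * φ + 1) p).proposal = some y →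
      (s (3 * φ + 1) p').proposal = some y' → y = y' := by
    intro p hp p' hp' y y' hy hy'
    rw [hs _ p hp] at hy
    rw [hs _ p' hp'] at hy'
    simp only [next, e0, if_true] at hy hy'
    have c1 := pick_spec hy
    have c2 := pick_spec hy'
    have c3 := Finset.card_union_add_card_inter
      (Finset.univ.filter fun q => rcv (3 * φ) p q = some y)
      (Finset.univ.filter fun q => rcv (3 * φ) p' q = some y')
    have c4 := Finset.card_le_univ ((Finset.univ.filter fun q => rcv (3 * φ) p q = some y) ∪
      (Finset.univ.filter fun q => rcv (3 * φ) p' q = some y'))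
    rw [Fintype.card_fin] at c4
    obtain ⟨q, hq, hq'⟩ := exists_mem_of_card_compl_lt hH
      (s := (Finset.univ.filter fun q => rcv (3 * φ) p q = some y) ∩
        (Finset.univ.filter fun q => rcv (3 * φ) p' q = some y')) (by omega)
    simp only [Finset.mem_inter, Finset.mem_filter, Finset.mem_univ, true_and] at hq'
    rw [hrcv _ p hp q hq, hrcv _ p' hp' q hq] at hq'
    exact Option.some.inj (hq'.1.symm.trans hq'.2)
  have hval : ∀ p ∈ H, (s (3 * φ + 2) p).val =
      (pick (t + 1) (rcv (3 * φ + 1) p)).getD (s (3 * φ + 1) p).val := by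
    intro p hp
    rw [hs (3 * φ + 1) p hp]
    simp [next, e1]
  have hpick : ∀ p ∈ H, ∀ m, t < m → ∀ z, pick m (rcv (3 * φ + 1) p) = some z →
      ∃ q ∈ H, (s (3 * φ + 1) q).proposal = some z := by
    intro p hp m hm z hz
    obtain ⟨q, hq, hq'⟩ := exists_mem_of_pick_eq_some hH hm hz
    rw [hrcv _ p hp q hq] at hq'
    exact ⟨q, hq, by simpa [msg, e1] using hq'⟩
  have hend : ∀ p ∈ H, (s (3 * (φ + 1)) p).val =
      if (s (3 * φ + 2) p).strong then (s (3 * φ + 2) p).val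
      else (s (3 * φ + 2) ⟨φ, hφ⟩).val := by
    intro p hp
    rw [show 3 * (φ + 1) = 3 * φ + 2 + 1 by ring, hs (3 * φ + 2) p hp]
    simp [next, e2, e3, hφ, hrcv _ p hp _ hking, msg]
  by_cases hst : ∃ p ∈ H, (s (3 * φ + 2) p).strong
  · obtain ⟨p, hp, hst⟩ := hst
    rw [hs (3 * φ + 1) p hp] at hst
    simp only [next, e1, if_true, if_neg one_ne_zero] at hst
    obtain ⟨z, hz⟩ := hst
    obtain ⟨q₀, hq₀, hq₀z⟩ := hpick p hp _ (by omega) z hz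
    -- At least `k - 2 * t ≥ t + 1` of the proposals seen by the strong party are honest and reach
    -- everyone. So all honest parties, the king included, hold `z`, and following the king or not
    -- makes no difference.
    have hall : ∀ p' ∈ H, (s (3 * φ + 2) p').val = z := by
      intro p' hp'
      have c1 := pick_spec hz
      have hsub : (Finset.univ.filter fun q => rcv (3 * φ + 1) p q = some z) \ Hᶜ ⊆
          Finset.univ.filter fun q => rcv (3 * φ + 1) p' q = some z := by
        intro q hq
        simp only [Finset.mem_sdiff, Finset.mem_filter, Finset.mem_univ, true_and,
          Finset.mem_compl, not_not] at hq ⊢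
        rw [hrcv _ p' hp' q hq.2, ← hrcv _ p hp q hq.2, hq.1]
      have c2 := Finset.card_le_card hsub
      have c3 := Finset.le_card_sdiff Hᶜ
        (Finset.univ.filter fun q => rcv (3 * φ + 1) p q = some z)
      obtain ⟨z', hz'⟩ := exists_pick_eq_some (f := rcv (3 * φ + 1) p') (m := t + 1) (y := z)
        (by omega)
      obtain ⟨q, hq, hqz⟩ := hpick p' hp' _ (by omega) z' hz'
      rw [hval p' hp', hz', hprop q hq q₀ hq₀ z' z hqz hq₀z]
      rfl
    exact ⟨z, fun p' hp' => by rw [hend p' hp', hall p' hp', hall _ hking, ite_self]⟩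
  · exact ⟨(s (3 * φ + 2) ⟨φ, hφ⟩).val, fun p hp => by
      rw [hend p hp, if_neg fun h => hst ⟨p, hp, h⟩]⟩

lemma persistent (hH : Hᶜ.card ≤ t) (ht : 3 * t < k)
    (hrcv : ∀ n, ∀ p ∈ H, ∀ q ∈ H, rcv n p q = (s n q).msg n)
    (hs : ∀ n, ∀ p ∈ H, s (n + 1) p = (s n p).next t n (rcv n p)) {φ ψ : ℕ} (hφ : φ ≤ ψ) {v : V}
    (h : ∀ p ∈ H, (s (3 * φ) p).val = v) : ∀ p ∈ H, (s (3 * ψ) p).val = v := by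
  induction ψ, hφ using Nat.le_induction with
  | base => exact h
  | succ ψ _ ih => exact phase_persistent hH ht hrcv hs ψ v ih

/-- Among `k` phases some king is honest; its phase creates agreement, which the later ones
preserve. -/
theorem agreement (hH : Hᶜ.card ≤ t) (ht : 3 * t < k)
    (hrcv : ∀ n, ∀ p ∈ H, ∀ q ∈ H, rcv n p q = (s n q).msg n)
    (hs : ∀ n, ∀ p ∈ H, s (n + 1) p = (s n p).next t n (rcv n p)) :
    ∃ v, ∀ p ∈ H, (s (3 * k) p).val = v := by
  have hHc : H.card + Hᶜ.card = k := by simp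
  obtain ⟨p, hp⟩ : H.Nonempty := Finset.card_pos.1 (by omega)
  obtain ⟨v, hv⟩ := phase_agreement hH ht hrcv hs p.val p.isLt hp
  exact ⟨v, persistent hH ht hrcv hs p.isLt hv⟩

end PhaseKing

/-! ### The protocol -/

instance : Inhabited (PrefList k) := ⟨1⟩

/-- The local state: a clock, the own input, the reports last received by a party of `R`, and the
states of a party of `L` in the `2 * k` instances of the phase king algorithm. -/
structure RelayState (k : ℕ) where
  time : ℕ
  pref : PrefList k
  relay : Fin k → Party k → Option (PrefList k)
  core : Party k → PhaseKing (PrefList k)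

/-- What a party of `L` reports on the input of `ι`. -/
def RelayState.report (s : RelayState k) (ι : Party k) : Option (PrefList k) :=
  -- A phase king round costs two network rounds, to `R` and back. The first pair of rounds
  -- distributes the inputs, hence the shift by one.
  if s.time < 2 then some s.pref else (s.core ι).msg (s.time / 2 - 1)

/-- The report of the party `q` of `L` on the input of `ι`, as relayed by the majority of `R`. -/
noncomputable def decode (tR : ℕ)
    (rcv : Party k → Option ((Fin k → Party k → Option (PrefList k)) × PrefList k))
    (ι : Party k) (q : Fin k) : Option (PrefList k) :=
  pick (tR + 1) fun j => (rcv (Sum.inr j)).bind fun m => m.1 q ι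

/-- The phase king state after the rounds `2 * n` and `2 * n + 1`. -/
noncomputable def coreUpdate (tL tR n : ℕ) (core : Party k → PhaseKing (PrefList k))
    (rcv : Party k → Option ((Fin k → Party k → Option (PrefList k)) × PrefList k)) (ι : Party k) :
    PhaseKing (PrefList k) :=
  match n with
  | 0 => match ι with
    | Sum.inl i => ⟨(decode tR rcv ι i).getD default, none, False⟩
    | Sum.inr _ => ⟨((rcv ι).map Prod.snd).getD default, none, False⟩
  | n + 1 => (core ι).next tL n (decode tR rcv ι)

/-- A stable matching for the given preference lists. -/
noncomputable def stableMatching (F : Party k → PrefList k) : Equiv.Perm (Fin k) :=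
  (exists_stable_matching (fun u => F (Sum.inl u)) (fun v => F (Sum.inr v))).choose

/-- The parties of `L` agree on all inputs with the phase king algorithm, where the parties of `R`
relay the messages. Then everyone computes the same stable matching. -/
noncomputable def relayProtocol (k tL tR : ℕ) : Protocol k where
  Msg := (Fin k → Party k → Option (PrefList k)) × PrefList k
  State := RelayState k
  init _ pref := ⟨0, pref, fun _ _ => none, fun _ => ⟨default, none, False⟩⟩
  send p s _ := match p with
    | Sum.inl _ => some (fun _ => s.report, s.pref)
    | Sum.inr _ => some (s.relay, s.pref)
  step p s rcv := match p with
    | Sum.inl _ => ⟨s.time + 1, s.pref, s.relay,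
        if s.time % 2 = 1 then coreUpdate tL tR (s.time / 2) s.core rcv else s.core⟩
    | Sum.inr _ => ⟨s.time + 1, s.pref, fun q ι => (rcv (Sum.inl q)).bind fun m => m.1 q ι, s.core⟩
  output p s := match p with
    | Sum.inl u => if s.time = 6 * k + 2 then
        some (some (stableMatching (fun ι => (s.core ι).val) u)) else none
    -- `L` finishes the `3 * k` phase king rounds at time `6 * k + 2`; one more round announces the
    -- agreed values to `R`.
    | Sum.inr v => if s.time = 6 * k + 3 then
        some (some ((stableMatching fun ι =>
          (pick (tL + 1) fun q => s.relay q ι).getD default).symm v)) else none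

/-! ### Correctness of the simulation of phase king over the relays. -/

section Relay

variable {tL tR : ℕ} (E : Execution (relayProtocol k tL tR) (bipartiteNetwork k))

/-- The local state of `p` at the beginning of round `r`. -/
noncomputable def Execution.relayState (r : ℕ) (p : Party k) : RelayState k :=
  (relayProtocol k tL tR).state (bipartiteNetwork k) E.input E.sent r p

open Classical in
/-- The messages that `p` receives in round `r`. -/
noncomputable def Execution.received (r : ℕ) (p q : Party k) :
    Option ((Fin k → Party k → Option (PrefList k)) × PrefList k) :=
  if (bipartiteNetwork k).Adj q p then E.sent r q p else none

lemma Execution.relayState_succ_inl (r : ℕ) (i : Fin k) :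
    E.relayState (r + 1) (Sum.inl i) =
      ⟨(E.relayState r (Sum.inl i)).time + 1, (E.relayState r (Sum.inl i)).pref,
        (E.relayState r (Sum.inl i)).relay,
        if (E.relayState r (Sum.inl i)).time % 2 = 1 then
          coreUpdate tL tR ((E.relayState r (Sum.inl i)).time / 2)
            (E.relayState r (Sum.inl i)).core (E.received r (Sum.inl i))
        else (E.relayState r (Sum.inl i)).core⟩ := rfl

lemma Execution.relayState_succ_inr (r : ℕ) (j : Fin k) :
    E.relayState (r + 1) (Sum.inr j) =
      ⟨(E.relayState r (Sum.inr j)).time + 1, (E.relayState r (Sum.inr j)).pref,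
        fun q ι => (E.received r (Sum.inr j) (Sum.inl q)).bind fun m => m.1 q ι,
        (E.relayState r (Sum.inr j)).core⟩ := rfl

lemma Execution.relayState_time (r : ℕ) (p : Party k) : (E.relayState r p).time = r := by
  induction r with
  | zero => rfl
  | succ r ih =>
    rcases p with i | j
    · rw [E.relayState_succ_inl, ih]
    · rw [E.relayState_succ_inr, ih]

lemma Execution.relayState_pref (r : ℕ) (p : Party k) : (E.relayState r p).pref = E.input p := by
  induction r with
  | zero => rfl
  | succ r ih =>
    rcases p with i | j
    · rw [E.relayState_succ_inl, ih]
    · rw [E.relayState_succ_inr, ih]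

lemma Execution.received_inr (r : ℕ) {i : Fin k} (hi : E.Honest (Sum.inl i)) (j : Fin k) :
    E.received r (Sum.inr j) (Sum.inl i) =
      some (fun _ => (E.relayState r (Sum.inl i)).report, E.input (Sum.inl i)) := by
  rw [← E.relayState_pref r (Sum.inl i)]
  refine (if_pos (by simp)).trans
    (E.follows r (Sum.inl i) ?_ (Sum.inr j))
  rw [show E.corruptedAt (Sum.inl i) = ⊤ from hi]
  exact ENat.natCast_lt_top r

lemma Execution.received_inl (r : ℕ) {j : Fin k} (hj : E.Honest (Sum.inr j)) (i : Fin k) :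
    E.received r (Sum.inl i) (Sum.inr j) =
      some ((E.relayState r (Sum.inr j)).relay, E.input (Sum.inr j)) := by
  rw [← E.relayState_pref r (Sum.inr j)]
  refine (if_pos (by simp)).trans
    (E.follows r (Sum.inr j) ?_ (Sum.inl i))
  rw [show E.corruptedAt (Sum.inr j) = ⊤ from hj]
  exact ENat.natCast_lt_top r

lemma Execution.relay_succ (r : ℕ) {i : Fin k} (hi : E.Honest (Sum.inl i)) (j : Fin k)
    (ι : Party k) : (E.relayState (r + 1) (Sum.inr j)).relay i ι =
      (E.relayState r (Sum.inl i)).report ι := by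
  rw [E.relayState_succ_inr]
  simp [E.received_inr r hi j]

variable {HL HR : Finset (Fin k)}

/-- All honest relays forward the same report of an honest `q`, and they outnumber the faulty ones.
A corrupted `q` may still be decoded differently by different receivers, which phase king tolerates.
-/
lemma Execution.decode_received (hR : ∀ j ∈ HR, E.Honest (Sum.inr j)) (hHR : HRᶜ.card ≤ tR)
    (htR : 2 * tR < k) (r : ℕ) (p : Fin k) {q : Fin k} (hq : E.Honest (Sum.inl q))
    (ι : Party k) : decode tR (E.received (r + 1) (Sum.inl p)) ι q =
      (E.relayState r (Sum.inl q)).report ι := by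
  refine pick_eq_of_forall_mem hHR (by omega) (by omega) fun j hj => ?_
  rw [E.received_inl (r + 1) (hR j hj) p, Option.bind_some]
  exact E.relay_succ r hq j ι

/-- The phase king state of the party `i` of `L` in the instance `ι` before the round
`2 * n + 2`. -/
noncomputable def Execution.coreAt (ι : Party k) (n : ℕ) (i : Fin k) : PhaseKing (PrefList k) :=
  (E.relayState (2 * n + 2) (Sum.inl i)).core ι

lemma Execution.core_two_mul_succ (n : ℕ) (i : Fin k) :
    (E.relayState (2 * n + 2) (Sum.inl i)).core =
      coreUpdate tL tR n (E.relayState (2 * n) (Sum.inl i)).core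
        (E.received (2 * n + 1) (Sum.inl i)) := by
  rw [E.relayState_succ_inl]
  simp only [E.relayState_time]
  rw [if_pos (by omega), E.relayState_succ_inl]
  simp only [E.relayState_time]
  rw [if_neg (by omega), show (2 * n + 1) / 2 = n by omega]

lemma Execution.report_two_mul_add_two (n : ℕ) (i : Fin k) (ι : Party k) :
    (E.relayState (2 * n + 2) (Sum.inl i)).report ι = (E.coreAt ι n i).msg n := by
  rw [RelayState.report, E.relayState_time, if_neg (by omega),
    show (2 * n + 2) / 2 - 1 = n by omega]
  rfl

lemma Execution.coreAt_zero (hR : ∀ j ∈ HR, E.Honest (Sum.inr j)) (hHR : HRᶜ.card ≤ tR)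
    (htR : 2 * tR < k) {ι : Party k} (hι : E.Honest ι) (p : Fin k) :
    (E.coreAt ι 0 p).val = E.input ι := by
  rw [Execution.coreAt, E.core_two_mul_succ]
  rcases ι with i | j
  · simp [coreUpdate, E.decode_received hR hHR htR 0 p hι, RelayState.report, E.relayState_time,
      E.relayState_pref]
  · simp [coreUpdate, E.received_inl _ hι]

/-- Agreement holds in every instance. If the owner of the input is honest, all honest parties of
`L` start with its value, so persistence from phase `0` gives validity. -/
lemma Execution.coreAt_final (hL : ∀ i ∈ HL, E.Honest (Sum.inl i)) (hHL : HLᶜ.card ≤ tL)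
    (htL : 3 * tL < k) (hR : ∀ j ∈ HR, E.Honest (Sum.inr j)) (hHR : HRᶜ.card ≤ tR)
    (htR : 2 * tR < k) (ι : Party k) :
    ∃ v, (∀ p ∈ HL, (E.coreAt ι (3 * k) p).val = v) ∧ (E.Honest ι → v = E.input ι) := by
  have hrcv : ∀ n, ∀ p ∈ HL, ∀ q ∈ HL,
      decode tR (E.received (2 * n + 3) (Sum.inl p)) ι q = (E.coreAt ι n q).msg n :=
    fun n p _ q hq => by
      rw [E.decode_received hR hHR htR (2 * n + 2) p (hL q hq), E.report_two_mul_add_two]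
  have hs : ∀ n, ∀ p ∈ HL, E.coreAt ι (n + 1) p =
      (E.coreAt ι n p).next tL n (decode tR (E.received (2 * n + 3) (Sum.inl p)) ι) :=
    fun n p _ => by
      rw [Execution.coreAt, E.core_two_mul_succ]
      rfl
  obtain ⟨v, hv⟩ := PhaseKing.agreement hHL htL hrcv hs
  refine ⟨v, hv, fun hι => ?_⟩
  have hcard : HL.card + HLᶜ.card = k := by simp
  obtain ⟨p, hp⟩ : HL.Nonempty := Finset.card_pos.1 (by omega)
  rw [← hv p hp]
  exact PhaseKing.persistent hHL htL hrcv hs (Nat.zero_le k)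
    (fun q _ => E.coreAt_zero hR hHR htR hι q) p hp

lemma Execution.outputs_inl (i : Fin k) (m : Option (Fin k)) : E.Outputs (Sum.inl i) m ↔
    m = some (stableMatching (fun ι => (E.coreAt ι (3 * k) i).val) i) := by
  have h : ∀ r, (relayProtocol k tL tR).output (Sum.inl i)
      ((relayProtocol k tL tR).state (bipartiteNetwork k) E.input E.sent r (Sum.inl i)) =
      if (E.relayState r (Sum.inl i)).time = 6 * k + 2 then some (some
        (stableMatching (fun ι => ((E.relayState r (Sum.inl i)).core ι).val) i)) else none :=
    fun r => rfl
  have hT : 6 * k + 2 = 2 * (3 * k) + 2 := by ring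
  simp only [Execution.Outputs, h, E.relayState_time]
  constructor
  · rintro ⟨r, hr, -⟩
    split_ifs at hr with h'
    rw [← Option.some.inj hr, h', hT]
    rfl
  · rintro rfl
    refine ⟨6 * k + 2, (if_pos rfl).trans ?_, fun r hr => if_neg hr.ne⟩
    rw [hT]
    rfl

lemma Execution.outputs_inr (j : Fin k) (m : Option (Fin k)) : E.Outputs (Sum.inr j) m ↔
    m = some ((stableMatching fun ι => (pick (tL + 1) fun q =>
      (E.relayState (6 * k + 3) (Sum.inr j)).relay q ι).getD default).symm j) := by
  have h : ∀ r, (relayProtocol k tL tR).output (Sum.inr j)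
      ((relayProtocol k tL tR).state (bipartiteNetwork k) E.input E.sent r (Sum.inr j)) =
      if (E.relayState r (Sum.inr j)).time = 6 * k + 3 then some (some
        ((stableMatching fun ι => (pick (tL + 1) fun q =>
          (E.relayState r (Sum.inr j)).relay q ι).getD default).symm j)) else none :=
    fun r => rfl
  simp only [Execution.Outputs, h, E.relayState_time]
  constructor
  · rintro ⟨r, hr, -⟩
    split_ifs at hr with h'
    rw [← Option.some.inj hr, h']
  · rintro rfl
    exact ⟨6 * k + 3, if_pos rfl, fun r hr => if_neg hr.ne⟩

end Relay

theorem solvable_of_third_of_half (kind : AdversaryKind) (tL tR : ℕ) (htL : 3 * tL < k)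
    (htR : 2 * tR < k) : BSMSolvable (bipartiteNetwork k) kind tL tR := by
  classical
  refine ⟨relayProtocol k tL tR, fun E hE => ?_⟩
  let HL : Finset (Fin k) := Finset.univ.filter fun i => E.Honest (Sum.inl i)
  let HR : Finset (Fin k) := Finset.univ.filter fun j => E.Honest (Sum.inr j)
  have hL : ∀ i, i ∈ HL ↔ E.Honest (Sum.inl i) := fun i => by simp [HL]
  have hR : ∀ j, j ∈ HR ↔ E.Honest (Sum.inr j) := fun j => by simp [HR]
  have hHL : HLᶜ.card ≤ tL := by
    refine le_trans (le_of_eq ?_) hE.1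
    congr 1
    ext i
    simp [hL, Execution.Honest]
  have hHR : HRᶜ.card ≤ tR := by
    refine le_trans (le_of_eq ?_) hE.2.1
    congr 1
    ext i
    simp [hR, Execution.Honest]
  choose F hF hFin using E.coreAt_final (fun i => (hL i).1) hHL htL (fun j => (hR j).1) hHR htR
  have oL : ∀ u m, E.Honest (Sum.inl u) →
      (E.Outputs (Sum.inl u) m ↔ m = some (stableMatching F u)) := fun u m hu => by
    rw [E.outputs_inl, funext fun ι => hF ι u ((hL u).2 hu)]
  have oR : ∀ v m, E.Honest (Sum.inr v) →
      (E.Outputs (Sum.inr v) m ↔ m = some ((stableMatching F).symm v)) := fun v m _ => by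
    -- As `3 * k` is a multiple of `3`, the report after the last phase is the value itself, and the
    -- honest parties of `L` all report `F ι`.
    have : ∀ ι, (pick (tL + 1) fun q => (E.relayState (6 * k + 3) (Sum.inr v)).relay q ι) =
        some (F ι) := fun ι => by
      refine pick_eq_of_forall_mem hHL (by omega) (by omega) fun q hq => ?_
      rw [E.relay_succ _ ((hL q).1 hq), show 6 * k + 2 = 2 * (3 * k) + 2 by ring,
        E.report_two_mul_add_two, PhaseKing.msg, if_neg (by omega), hF ι q hq]
    rw [E.outputs_inr]
    simp only [this, Option.getD_some]
  refine ⟨?_, fun u v hu hv => ?_, fun u v hb => ?_, ?_, ?_⟩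
  · rintro (u | v) hp
    · exact ⟨_, (oL u _ hp).2 rfl⟩
    · exact ⟨_, (oR v _ hp).2 rfl⟩
  · rw [oL u _ hu, oR v _ hv, Option.some_inj, Option.some_inj, Equiv.eq_symm_apply, eq_comm]
  · obtain ⟨hu, hv, m, m', hm, hm', hp, hp'⟩ := hb
    -- Validity matters here: for honest `u` and `v` the agreed lists are the true ones.
    rw [(oL u m hu).1 hm, ← hFin _ hu] at hp
    rw [(oR v m' hv).1 hm', ← hFin _ hv] at hp'
    exact (exists_stable_matching (fun u => F (Sum.inl u))
      (fun v => F (Sum.inr v))).choose_spec u v ⟨hp, hp'⟩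
  · intro u u' v huu hu hu' ⟨h, h'⟩
    rw [oL u _ hu, Option.some_inj] at h
    rw [oL u' _ hu', Option.some_inj] at h'
    exact huu ((stableMatching F).injective (h.symm.trans h'))
  · intro v v' u hvv hv hv' ⟨h, h'⟩
    rw [oR v _ hv, Option.some_inj] at h
    rw [oR v' _ hv', Option.some_inj] at h'
    exact hvv ((stableMatching F).symm.injective (h.symm.trans h'))

end ByzantineMatching

/-! ### The equivalence, assembled up to exchanging the sides. -/

theorem mainTheorem2 (k tL tR : ℕ) (hk : 2 ≤ k) (kind : ByzantineMatching.AdversaryKind) :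
    ByzantineMatching.BSMSolvable (ByzantineMatching.bipartiteNetwork k) kind tL tR ↔
      ((tL : ℚ) < (k : ℚ) / 2 ∧ (tR : ℚ) < (k : ℚ) / 2) ∧
        ((tL : ℚ) < (k : ℚ) / 3 ∨ (tR : ℚ) < (k : ℚ) / 3) := by
  have h2 : ∀ t : ℕ, (t : ℚ) < (k : ℚ) / 2 ↔ 2 * t < k := fun t => by
    rw [lt_div_iff₀ (by norm_num), mul_comm]
    exact_mod_cast Iff.rfl
  have h3 : ∀ t : ℕ, (t : ℚ) < (k : ℚ) / 3 ↔ 3 * t < k := fun t => by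
    rw [lt_div_iff₀ (by norm_num), mul_comm]
    exact_mod_cast Iff.rfl
  rw [h2, h2, h3, h3]
  constructor
  · intro h
    refine ⟨⟨?_, ?_⟩, ?_⟩
    · by_contra hc
      exact ByzantineMatching.not_solvable_of_half hk kind tL tR (not_lt.1 hc) h
    · by_contra hc
      exact ByzantineMatching.not_solvable_of_half hk kind tR tL (not_lt.1 hc) h.swap
    · by_contra! hc
      exact ByzantineMatching.not_solvable_of_third hk kind tL tR hc.1 hc.2 h
  · rintro ⟨⟨hL, hR⟩, h | h⟩
    · exact ByzantineMatching.solvable_of_third_of_half kind tL tR h hR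
    · exact (ByzantineMatching.solvable_of_third_of_half kind tR tL h hL).swap
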